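/- For a commutative ring $A$ with unit, let $E_2(A)\subseteq SL_2(A)$ denote the subgroup of $GL_2(A)$ generated by the elementary matrices $\begin{pmatrix}1&a\\0&1\end{pmatrix}$, $\begin{pmatrix}1&0\\a&1\end{pmatrix}$ ($a\in A$), and let $B(A)$ denote the subgroup of upper triangular matrices in $SL_2(A)$; one has $B(A)\subseteq E_2(A)$. Let $R$ be an integral domain and $R[t]$ the polynomial ring over $R$, and regard matrices over $R$ as matrices over $R[t]$ with constant entries. Then there is an amalgamated free product decomposition $$E_2(R[t])\;\cong\; E_2(R) *_{B(R)} B(R[t]).$$ More precisely, the inclusions $B(R)\to E_2(R)$ and $B(R)\to B(R[t])$ are injective, and there is an isomorphism from the amalgamated free product (pushout of groups) $E_2(R) *_{B(R)} B(R[t])$ onto $E_2(R[t])$ which restricts to the inclusions $E_2(R)\hookrightarrow E_2(R[t])$ and $B(R[t])\hookrightarrow E_2(R[t])$ on the two factors. -/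

import Mathlib

open Matrix Polynomial
open scoped MatrixGroups

universe u

/-- `E_n(A)`: the subgroup generated by the elementary matrices `1 + a e_ij`, `i ≠ j`. These have
determinant one, so the subgroup they generate in `GL_n(A)` lies in `SL_n(A)`
(see `map_elementaryGroup`), and `E_n(A)` is taken inside `SL_n(A)`. -/
def elementaryGroup (n : Type*) [Fintype n] [DecidableEq n] (A : Type*) [CommRing A] :
    Subgroup (SpecialLinearGroup n A) :=
  Subgroup.closure {g | ∃ (i j : n) (a : A), i ≠ j ∧ (g : Matrix n n A) = transvection i j a}

theorem map_elementaryGroup (n : Type*) [Fintype n] [DecidableEq n] (A : Type*) [CommRing A] :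
    (elementaryGroup n A).map SpecialLinearGroup.toGL =
      Subgroup.closure
        {g : GL n A | ∃ (i j : n) (a : A), i ≠ j ∧ (g : Matrix n n A) = transvection i j a} := by
  rw [elementaryGroup, MonoidHom.map_closure]
  congr 1
  ext g
  constructor
  · rintro ⟨s, ⟨i, j, a, hij, hs⟩, rfl⟩
    exact ⟨i, j, a, hij, hs⟩
  · rintro ⟨i, j, a, hij, hg⟩
    refine ⟨⟨transvection i j a, det_transvection_of_ne i j hij a⟩, ⟨i, j, a, hij, rfl⟩, ?_⟩
    exact Units.ext hg.symm

/-- `B(A)`: the subgroup of upper triangular matrices in `SL_2(A)`. -/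
def upperTriangularGroup (A : Type*) [CommRing A] : Subgroup SL(2, A) where
  carrier := {g | g 1 0 = 0}
  one_mem' := by simp
  mul_mem' := by
    intro g h hg hh
    simp only [Set.mem_setOf_eq] at hg hh ⊢
    simp [Matrix.mul_apply, Fin.sum_univ_two, hg, hh]
  inv_mem' := by
    intro g hg
    simp only [Set.mem_setOf_eq] at hg ⊢
    simp [SpecialLinearGroup.coe_inv, adjugate_fin_two, hg]

theorem upperTriangularGroup_le (A : Type*) [CommRing A] :
    upperTriangularGroup A ≤ elementaryGroup (Fin 2) A := by
  intro g hg
  have hg' : g 1 0 = 0 := hg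
  have hdet : g 0 0 * g 1 1 = 1 := by
    have h := g.det_coe
    rw [det_fin_two] at h
    simpa [hg'] using h
  have hE : ∀ (i j : Fin 2) (hij : i ≠ j) (a : A),
      SpecialLinearGroup.transvection hij a ∈ elementaryGroup (Fin 2) A :=
    fun i j hij a => Subgroup.subset_closure ⟨i, j, a, hij, rfl⟩
  have h01 : (0 : Fin 2) ≠ 1 := zero_ne_one
  have h10 : (1 : Fin 2) ≠ 0 := one_ne_zero
  have key : g = SpecialLinearGroup.transvection h01 (g 0 0 * g 0 1) *
      (SpecialLinearGroup.transvection h01 (g 0 0) *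
        SpecialLinearGroup.transvection h10 (-(g 1 1)) *
        SpecialLinearGroup.transvection h01 (g 0 0) *
        SpecialLinearGroup.transvection h01 (-1) *
        SpecialLinearGroup.transvection h10 1 *
        SpecialLinearGroup.transvection h01 (-1)) := by
    ext i j
    fin_cases i <;> fin_cases j <;>
      simp [SpecialLinearGroup.transvection_coe, Matrix.mul_apply, Fin.sum_univ_two,
        Matrix.add_apply, Matrix.single_apply, hg'] <;>
      grind
  rw [key]
  exact mul_mem (hE _ _ _ _) (mul_mem (mul_mem (mul_mem (mul_mem (mul_mem (hE _ _ _ _)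
    (hE _ _ _ _)) (hE _ _ _ _)) (hE _ _ _ _)) (hE _ _ _ _)) (hE _ _ _ _))

/-- The inclusion `B(A) → E_2(A)`. -/
def upperTriangularInclusion (A : Type*) [CommRing A] :
    upperTriangularGroup A →* elementaryGroup (Fin 2) A :=
  Subgroup.inclusion (upperTriangularGroup_le A)

/-- The inclusion `B(R) → B(R[t])` as constant matrices. -/
noncomputable def upperTriangularConst (R : Type*) [CommRing R] :
    upperTriangularGroup R →* upperTriangularGroup R[X] :=
  ((SpecialLinearGroup.map (n := Fin 2) (C : R →+* R[X])).comp
    (upperTriangularGroup R).subtype).codRestrict (upperTriangularGroup R[X]) (by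
      rintro ⟨g, hg⟩
      have hg' : g 1 0 = 0 := hg
      change C (g 1 0) = 0
      rw [hg', map_zero])

/-- The two factors of an amalgamated product, as a family indexed by `Bool`. -/
def AmalgamFactor (G₁ G₂ : Type u) : Bool → Type u
  | false => G₁
  | true => G₂

instance (G₁ G₂ : Type u) [Group G₁] [Group G₂] : ∀ i, Group (AmalgamFactor G₁ G₂ i)
  | false => inferInstanceAs (Group G₁)
  | true => inferInstanceAs (Group G₂)

/-- Two homomorphisms `A → G₁`, `A → G₂`, as a family indexed by `Bool`. -/
def amalgamHom {A : Type*} {G₁ G₂ : Type u} [Group A] [Group G₁] [Group G₂]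
    (f₁ : A →* G₁) (f₂ : A →* G₂) : ∀ i, A →* AmalgamFactor G₁ G₂ i
  | false => f₁
  | true => f₂

/-- The amalgamated free product `G₁ *_A G₂`, that is, the pushout in the category of groups of
`f₁ : A → G₁` and `f₂ : A → G₂`. -/
abbrev Amalgam {A : Type*} {G₁ G₂ : Type u} [Group A] [Group G₁] [Group G₂]
    (f₁ : A →* G₁) (f₂ : A →* G₂) : Type _ :=
  Monoid.PushoutI (amalgamHom f₁ f₂)

/-- The canonical homomorphism `G₁ → G₁ *_A G₂`. -/
def Amalgam.inl {A : Type*} {G₁ G₂ : Type u} [Group A] [Group G₁] [Group G₂]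
    (f₁ : A →* G₁) (f₂ : A →* G₂) : G₁ →* Amalgam f₁ f₂ :=
  Monoid.PushoutI.of (φ := amalgamHom f₁ f₂) false

/-- The canonical homomorphism `G₂ → G₁ *_A G₂`. -/
def Amalgam.inr {A : Type*} {G₁ G₂ : Type u} [Group A] [Group G₁] [Group G₂]
    (f₁ : A →* G₁) (f₂ : A →* G₂) : G₂ →* Amalgam f₁ f₂ :=
  Monoid.PushoutI.of (φ := amalgamHom f₁ f₂) true

/-! Surjectivity: `B(R[t])` contains all upper elementary matrices, and a constant Weyl element
conjugates them to the lower ones. Injectivity is ping-pong on the degrees of the first column `(p,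
q)`. A factor from `E_2(R)` outside `B(R)` turns `deg q < deg p` into `deg p ≤ deg q`
(`IsTopHeavy.map_mul`). A factor from `B(R[t])` outside `B(R)` turns it back and leaves `q ≠ 0`
(`IsBottomHeavy.mul`). So a nonempty reduced word never lands in `B(R)`, which suffices by
`injective_of_reduced`. -/

namespace Monoid.PushoutI

open Monoid CoprodI Subgroup.IsComplement

variable {ι H : Type*} {G : ι → Type*} [Group H] [∀ i, Group (G i)] {φ : ∀ i, H →* G i}

/-- The transversal represents the base coset by `1`, so a nontrivial representative lies outside
the base group. -/
theorem NormalWord.reduced {d : NormalWord.Transversal φ} (w : NormalWord d) :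
    Reduced φ w.toWord := by
  rintro ⟨i, g⟩ hg hr
  refine w.ne_one _ hg ?_
  rw [← SetLike.mem_coe, ← coe_equiv_snd_eq_one_iff_mem (d.compl i) (d.one_mem _),
    (equiv_snd_eq_self_iff_mem (d.compl i) (Subgroup.one_mem _)).2 (w.normalized i g hg)] at hr
  exact hr

theorem exists_eq_base_mul_reduced (hφ : ∀ i, Function.Injective (φ i)) (x : PushoutI φ) :
    ∃ (h : H) (w : Word G), Reduced φ w ∧ x = base φ h * ofCoprodI w.prod := by
  classical
  obtain ⟨d⟩ := NormalWord.transversal_nonempty φ hφ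
  obtain ⟨w, rfl⟩ := (NormalWord.equiv (d := d)).symm.surjective x
  exact ⟨w.head, w.toWord, w.reduced, rfl⟩

/-- A homomorphism out of an amalgamated product is injective as soon as it is injective on the
base group and no nonempty reduced word is mapped into the image of the base group. -/
theorem injective_of_reduced {K : Type*} [Group K] (hφ : ∀ i, Function.Injective (φ i))
    (f : PushoutI φ →* K) (hbase : Function.Injective (f.comp (base φ)))
    (hred : ∀ w : Word G, Reduced φ w → f (ofCoprodI w.prod) ∈ (f.comp (base φ)).range →
      w = .empty) : Function.Injective f := by
  rw [injective_iff_map_eq_one]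
  intro x hx
  obtain ⟨h, w, hw, rfl⟩ := exists_eq_base_mul_reduced hφ x
  rw [map_mul] at hx
  have hwe : w = .empty := hred w hw ⟨h⁻¹, by
    rw [map_inv, MonoidHom.comp_apply]
    exact inv_eq_of_mul_eq_one_right hx⟩
  subst hwe
  rw [Word.prod_empty, map_one, map_one, mul_one] at hx
  rw [Word.prod_empty, map_one, mul_one]
  have : h = 1 := hbase (by simpa using hx)
  rw [this, map_one]

end Monoid.PushoutI

open Monoid Monoid.CoprodI

theorem upperTriangularConst_injective (R : Type*) [CommRing R] :
    Function.Injective (upperTriangularConst R) := by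
  intro g h hgh
  ext i j
  exact C_injective (congrArg (fun b : upperTriangularGroup R[X] => (b : SL(2, R[X])) i j) hgh)

theorem det_of_mem_upperTriangularGroup {A : Type*} [CommRing A] {g : SL(2, A)}
    (hg : g ∈ upperTriangularGroup A) : g 0 0 * g 1 1 = 1 := by
  have hg' : g 1 0 = 0 := hg
  have h := g.det_coe
  rw [det_fin_two] at h
  simpa [hg'] using h

section Map

variable {A B : Type*} [CommRing A] [CommRing B]

theorem map_mem_elementaryGroup (f : A →+* B) {g : SL(2, A)}
    (hg : g ∈ elementaryGroup (Fin 2) A) :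
    SpecialLinearGroup.map f g ∈ elementaryGroup (Fin 2) B := by
  suffices elementaryGroup (Fin 2) A ≤
      (elementaryGroup (Fin 2) B).comap (SpecialLinearGroup.map f) from this hg
  rw [elementaryGroup, Subgroup.closure_le]
  rintro g ⟨i, j, a, hij, hg⟩
  refine Subgroup.subset_closure ⟨i, j, f a, hij, ?_⟩
  rw [SpecialLinearGroup.map_apply_coe, hg]
  ext k l
  simp [transvection, Matrix.one_apply, Matrix.single_apply, apply_ite f]

/-- The homomorphism `E_2(A) → E_2(B)` induced by a ring homomorphism `A → B`. -/
def elementaryGroupMap (f : A →+* B) :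
    elementaryGroup (Fin 2) A →* elementaryGroup (Fin 2) B :=
  ((SpecialLinearGroup.map (n := Fin 2) f).comp (elementaryGroup (Fin 2) A).subtype).codRestrict
    (elementaryGroup (Fin 2) B) fun g => map_mem_elementaryGroup f g.2

end Map

/-! ### Ping-pong on the degrees of the first column -/

section Degree

variable {R : Type*} [CommRing R] [IsDomain R]

/-- The diagonal entries are mutually inverse units of `R[t]`, hence constants over a domain, so
only the upper right entry can be nonconstant. -/
theorem degree_apply_zero_one_pos {b : upperTriangularGroup R[X]}
    (hb : b ∉ (upperTriangularConst R).range) : 0 < ((b : SL(2, R[X])) 0 1).degree := by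
  by_contra hdeg
  have hdet := det_of_mem_upperTriangularGroup b.2
  have h10 : (b : SL(2, R[X])) 1 0 = 0 := b.2
  obtain ⟨u, -, hu⟩ := Polynomial.isUnit_iff.1 (IsUnit.of_mul_eq_one _ hdet)
  obtain ⟨v, -, hv⟩ := Polynomial.isUnit_iff.1 (IsUnit.of_mul_eq_one_right _ hdet)
  have hc := eq_C_of_degree_le_zero (not_lt.1 hdeg)
  have huv : u * v = 1 := C_injective (by rw [C_mul, hu, hv, hdet, C_1])
  refine hb ⟨⟨⟨!![u, ((b : SL(2, R[X])) 0 1).coeff 0; 0, v], by simp [det_fin_two, huv]⟩, rfl⟩, ?_⟩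
  ext i j : 2
  fin_cases i <;> fin_cases j
  · exact hu
  · exact hc.symm
  · exact (C_0 (R := R)).trans h10.symm
  · exact hv

/-- The matrices whose first column `(p, q)` satisfies `deg q < deg p`. -/
def IsTopHeavy (M : SL(2, R[X])) : Prop := (M 1 0).degree < (M 0 0).degree

/-- The matrices whose first column `(p, q)` satisfies `deg p ≤ deg q`. -/
def IsBottomHeavy (M : SL(2, R[X])) : Prop := (M 0 0).degree ≤ (M 1 0).degree

/-- Since `degree 0 = ⊥`, a zero lower entry would force a zero first column, contradicting
determinant one. -/
theorem IsBottomHeavy.apply_one_zero_ne_zero {M : SL(2, R[X])} (hM : IsBottomHeavy M) :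
    M 1 0 ≠ 0 := by
  intro h
  have h0 : M 0 0 = 0 := by simpa [IsBottomHeavy, h] using hM
  have := M.det_coe
  rw [det_fin_two] at this
  simp [h, h0] at this

theorem isTopHeavy_of_mem {M : SL(2, R[X])} (hM : M ∈ upperTriangularGroup R[X]) :
    IsTopHeavy M := by
  have h10 : M 1 0 = 0 := hM
  rw [IsTopHeavy, h10, degree_zero, bot_lt_iff_ne_bot, Ne, degree_eq_bot]
  exact left_ne_zero_of_mul_eq_one (det_of_mem_upperTriangularGroup hM)

/-- With bottom row `(c, d)` of `g` and `c ≠ 0`, the term `c p` dominates `c p + d q`. The new lower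
entry thus has degree exactly `deg p`, which the new upper entry cannot exceed. -/
theorem IsTopHeavy.map_mul {M : SL(2, R[X])} (hM : IsTopHeavy M) {g : SL(2, R)}
    (hg : g ∉ upperTriangularGroup R) :
    IsBottomHeavy (SpecialLinearGroup.map (C : R →+* R[X]) g * M) := by
  have hc : g 1 0 ≠ 0 := hg
  have h0 : (SpecialLinearGroup.map (C : R →+* R[X]) g * M) 0 0 =
      C (g 0 0) * M 0 0 + C (g 0 1) * M 1 0 := by
    simp [Matrix.mul_apply, Fin.sum_univ_two]
  have h1 : (SpecialLinearGroup.map (C : R →+* R[X]) g * M) 1 0 =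
      C (g 1 0) * M 0 0 + C (g 1 1) * M 1 0 := by
    simp [Matrix.mul_apply, Fin.sum_univ_two]
  have hle : ∀ (a : R) (p : R[X]), (C a * p).degree ≤ p.degree := fun a p => by
    rw [← smul_eq_C_mul]; exact degree_smul_le a p
  have h1' : (C (g 1 0) * M 0 0 + C (g 1 1) * M 1 0).degree = (M 0 0).degree := by
    rw [degree_add_eq_left_of_degree_lt, degree_C_mul hc]
    rw [degree_C_mul hc]
    exact (hle _ _).trans_lt hM
  rw [IsBottomHeavy, h0, h1, h1']
  exact (degree_add_le _ _).trans (max_le (hle _ _) ((hle _ _).trans hM.le))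

/-- The diagonal units preserve degrees, while the upper right entry times `q` has degree above `deg
q ≥ deg p` and so dominates the new upper entry. -/
theorem IsBottomHeavy.mul {M : SL(2, R[X])} (hM : IsBottomHeavy M)
    {b : upperTriangularGroup R[X]} (hb : b ∉ (upperTriangularConst R).range) :
    ((b : SL(2, R[X])) * M) 1 0 ≠ 0 ∧ IsTopHeavy ((b : SL(2, R[X])) * M) := by
  have h10 : (b : SL(2, R[X])) 1 0 = 0 := b.2
  have hpos : 0 < ((b : SL(2, R[X])) 0 1).degree := degree_apply_zero_one_pos hb
  have hdet := det_of_mem_upperTriangularGroup b.2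
  have hne := hM.apply_one_zero_ne_zero
  have hdegle : ∀ {u v : R[X]}, u * v = 1 → u.degree = 0 := fun h =>
    degree_eq_zero_of_isUnit (IsUnit.of_mul_eq_one _ h)
  have hu := hdegle hdet
  have hv := hdegle ((mul_comm _ _).trans hdet)
  have h0 : ((b : SL(2, R[X])) * M) 0 0 =
      (b : SL(2, R[X])) 0 0 * M 0 0 + (b : SL(2, R[X])) 0 1 * M 1 0 := by
    simp [Matrix.mul_apply, Fin.sum_univ_two]
  have h1 : ((b : SL(2, R[X])) * M) 1 0 = (b : SL(2, R[X])) 1 1 * M 1 0 := by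
    simp [Matrix.mul_apply, Fin.sum_univ_two, h10]
  have hlt : (M 1 0).degree < ((b : SL(2, R[X])) 0 1 * M 1 0).degree := by
    rw [degree_mul, degree_eq_natDegree hne,
      degree_eq_natDegree (ne_zero_of_degree_gt hpos), ← Nat.cast_add, Nat.cast_lt]
    have := natDegree_pos_iff_degree_pos.2 hpos
    omega
  refine ⟨?_, ?_⟩
  · rw [h1]
    exact mul_ne_zero (right_ne_zero_of_mul_eq_one hdet) hne
  · rw [IsTopHeavy, h0, h1, degree_mul, hv, zero_add, degree_add_eq_right_of_degree_lt]
    · exact hlt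
    · rw [degree_mul, hu, zero_add]
      exact lt_of_le_of_lt hM hlt

end Degree

/-! ### The map from the amalgam to `E_2(R[t])` is bijective -/

section Amalgam

variable (R : Type u) [CommRing R]

theorem amalgamHom_injective :
    ∀ i, Function.Injective (amalgamHom (upperTriangularInclusion R) (upperTriangularConst R) i)
  | false => Subgroup.inclusion_injective (upperTriangularGroup_le R)
  | true => upperTriangularConst_injective R

/-- The inclusions of the two factors `E_2(R)` and `B(R[t])` into `E_2(R[t])`. -/
noncomputable def amalgamFactorHom : ∀ i,
    AmalgamFactor (elementaryGroup (Fin 2) R) (upperTriangularGroup R[X]) i →*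
      elementaryGroup (Fin 2) R[X]
  | false => elementaryGroupMap C
  | true => upperTriangularInclusion R[X]

/-- The canonical homomorphism `E_2(R) *_{B(R)} B(R[t]) → E_2(R[t])`. -/
noncomputable def amalgamToElementaryGroup :
    Amalgam (upperTriangularInclusion R) (upperTriangularConst R) →*
      elementaryGroup (Fin 2) R[X] :=
  PushoutI.lift (amalgamFactorHom R)
    ((upperTriangularInclusion R[X]).comp (upperTriangularConst R)) (by
      rintro (_ | _) <;> rfl)

theorem amalgamToElementaryGroup_of (i : Bool)
    (g : AmalgamFactor (elementaryGroup (Fin 2) R) (upperTriangularGroup R[X]) i) :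
    amalgamToElementaryGroup R (PushoutI.of i g) = amalgamFactorHom R i g :=
  PushoutI.lift_of ..

theorem amalgamToElementaryGroup_base (h : upperTriangularGroup R) :
    amalgamToElementaryGroup R (PushoutI.base _ h) =
      upperTriangularInclusion R[X] (upperTriangularConst R h) :=
  PushoutI.lift_base ..

theorem amalgamToElementaryGroup_surjective :
    Function.Surjective (amalgamToElementaryGroup R) := by
  let S := (amalgamToElementaryGroup R).range.map (elementaryGroup (Fin 2) R[X]).subtype
  have hE : ∀ g ∈ elementaryGroup (Fin 2) R, SpecialLinearGroup.map (C : R →+* R[X]) g ∈ S :=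
    fun g hg => ⟨_, ⟨PushoutI.of false ⟨g, hg⟩, amalgamToElementaryGroup_of R false _⟩, rfl⟩
  have hB : upperTriangularGroup R[X] ≤ S :=
    fun g hg => ⟨_, ⟨PushoutI.of true ⟨g, hg⟩, amalgamToElementaryGroup_of R true _⟩, rfl⟩
  have h01 : (0 : Fin 2) ≠ 1 := zero_ne_one
  have h10 : (1 : Fin 2) ≠ 0 := one_ne_zero
  have hU : ∀ a : R[X], SpecialLinearGroup.transvection h01 a ∈ S := fun a => hB (by
    change (transvection 0 1 a : Matrix (Fin 2) (Fin 2) R[X]) 1 0 = 0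
    simp [transvection])
  have hL : ∀ a : R, SpecialLinearGroup.transvection h10 (C a) ∈ S := fun a => by
    convert hE (SpecialLinearGroup.transvection h10 a) (Subgroup.subset_closure ⟨1, 0, a, h10, rfl⟩)
    ext i j : 1
    simp [SpecialLinearGroup.transvection_coe, Matrix.one_apply, Matrix.single_apply,
      apply_ite (C : R →+* R[X])]
  -- This is the Weyl element `!![0, 1; -1, 0]`.
  have hw : SpecialLinearGroup.transvection h01 (1 : R[X]) *
      SpecialLinearGroup.transvection h10 (C (-1)) * SpecialLinearGroup.transvection h01 1 ∈ S :=
    mul_mem (mul_mem (hU 1) (hL (-1))) (hU 1)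
  have hS : elementaryGroup (Fin 2) R[X] ≤ S := by
    rw [elementaryGroup, Subgroup.closure_le]
    rintro g ⟨i, j, a, hij, hg⟩
    obtain ⟨rfl, rfl⟩ | ⟨rfl, rfl⟩ : i = 0 ∧ j = 1 ∨ i = 1 ∧ j = 0 := by omega
    · have hga : g = SpecialLinearGroup.transvection h01 a := Subtype.ext hg
      exact hga ▸ hU a
    · have hga : g = SpecialLinearGroup.transvection h10 a := Subtype.ext hg
      set w := SpecialLinearGroup.transvection h01 (1 : R[X]) *
        SpecialLinearGroup.transvection h10 (C (-1)) * SpecialLinearGroup.transvection h01 1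
      have hconj : g * w = w * SpecialLinearGroup.transvection h01 (-a) := by
        ext i j : 1
        fin_cases i <;> fin_cases j <;>
          simp [w, hga, SpecialLinearGroup.transvection_coe, Matrix.mul_apply,
            Fin.sum_univ_two, Matrix.single_apply]
      rw [SetLike.mem_coe, ← S.mul_mem_cancel_right hw, hconj]
      exact mul_mem hw (hU _)
  intro g
  obtain ⟨_, ⟨x, rfl⟩, hx⟩ := hS g.2
  exact ⟨x, Subtype.ext hx⟩

variable [IsDomain R]

/-- The ping-pong argument: the image in `E_2(R[t])` of a nonempty reduced word. -/
theorem amalgamToElementaryGroup_reduced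
    (w : Word (AmalgamFactor (elementaryGroup (Fin 2) R) (upperTriangularGroup R[X])))
    (hw : PushoutI.Reduced (amalgamHom (upperTriangularInclusion R) (upperTriangularConst R)) w) :
    letI M : SL(2, R[X]) := (amalgamToElementaryGroup R (PushoutI.ofCoprodI w.prod)).1
    (w.fstIdx = none → w = .empty) ∧ (w.fstIdx = some false → IsBottomHeavy M) ∧
      (w.fstIdx = some true → IsTopHeavy M ∧
        (M 1 0 ≠ 0 ∨ ∃ b ∉ (upperTriangularConst R).range, M = b)) := by
  induction w using Word.consRecOn with
  | empty => simp [Word.fstIdx, Word.empty]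
  | cons i g w hi hg ih =>
    obtain ⟨hnone, hfalse, htrue⟩ := ih fun _ hl => hw _ (List.mem_cons_of_mem _ hl)
    have hgr := hw ⟨i, g⟩ List.mem_cons_self
    have hprod : amalgamToElementaryGroup R (PushoutI.ofCoprodI (Word.cons g w hi hg).prod) =
        amalgamFactorHom R i g * amalgamToElementaryGroup R (PushoutI.ofCoprodI w.prod) := by
      rw [Word.prod_cons, map_mul, map_mul, PushoutI.ofCoprodI_of, amalgamToElementaryGroup_of]
    rw [Word.fstIdx_cons, hprod, Subgroup.coe_mul]
    have hempty : w = .empty →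
        ((amalgamToElementaryGroup R (PushoutI.ofCoprodI w.prod)).1 : SL(2, R[X])) = 1 := by
      rintro rfl
      simp
    generalize ((amalgamToElementaryGroup R (PushoutI.ofCoprodI w.prod)).1 : SL(2, R[X])) = M at *
    cases i with
    | false =>
      refine ⟨nofun, fun _ => ?_, nofun⟩
      have hM : IsTopHeavy M := by
        match hidx : w.fstIdx with
        | none => exact hempty (hnone hidx) ▸ isTopHeavy_of_mem (one_mem _)
        | some true => exact (htrue hidx).1
        | some false => exact absurd hidx hi
      exact hM.map_mul fun hmem => hgr ⟨⟨_, hmem⟩, rfl⟩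
    | true =>
      refine ⟨nofun, nofun, fun _ => ?_⟩
      match hidx : w.fstIdx with
      -- A single letter of `B(R[t])` has lower left entry zero, so here only its not being constant
      -- keeps it out of `B(R)`; hence the second alternative.
      | none =>
        rw [hempty (hnone hidx), mul_one]
        exact ⟨isTopHeavy_of_mem g.2, .inr ⟨g, hgr, rfl⟩⟩
      | some true => exact absurd hidx hi
      | some false =>
        have := (hfalse hidx).mul hgr
        exact ⟨this.2, .inl this.1⟩

theorem amalgamToElementaryGroup_injective :
    Function.Injective (amalgamToElementaryGroup R) := by
  refine PushoutI.injective_of_reduced (amalgamHom_injective R) _ ?_ ?_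
  · intro g h hgh
    simp only [MonoidHom.comp_apply, amalgamToElementaryGroup_base] at hgh
    exact upperTriangularConst_injective R (Subgroup.inclusion_injective _ hgh)
  · rintro w hw ⟨h, hh⟩
    obtain ⟨hnone, hfalse, htrue⟩ := amalgamToElementaryGroup_reduced R w hw
    rw [← hh, MonoidHom.comp_apply, amalgamToElementaryGroup_base] at hfalse htrue
    have h10 : (upperTriangularConst R h : SL(2, R[X])) 1 0 = 0 := (upperTriangularConst R h).2
    match hidx : w.fstIdx with
    | none => exact hnone hidx
    | some false => exact absurd h10 (hfalse hidx).apply_one_zero_ne_zero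
    | some true =>
      obtain hne | ⟨b, hb, hhb⟩ := (htrue hidx).2
      · exact absurd h10 hne
      · exact absurd ⟨h, Subtype.ext hhb⟩ hb

end Amalgam

theorem mainTheorem2 (R : Type u) [CommRing R] [IsDomain R] :
    Function.Injective (upperTriangularInclusion R) ∧
    Function.Injective (upperTriangularConst R) ∧
    ∃ e : Amalgam (upperTriangularInclusion R) (upperTriangularConst R) ≃*
        elementaryGroup (Fin 2) R[X],
      (∀ g : elementaryGroup (Fin 2) R,
        (e (Amalgam.inl (upperTriangularInclusion R) (upperTriangularConst R) g) : SL(2, R[X])) =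
          SpecialLinearGroup.map (C : R →+* R[X]) (g : SL(2, R))) ∧
      (∀ b : upperTriangularGroup R[X],
        (e (Amalgam.inr (upperTriangularInclusion R) (upperTriangularConst R) b) : SL(2, R[X])) =
          (b : SL(2, R[X]))) := by
  refine ⟨Subgroup.inclusion_injective _, upperTriangularConst_injective R,
    MulEquiv.ofBijective (amalgamToElementaryGroup R)
      ⟨amalgamToElementaryGroup_injective R, amalgamToElementaryGroup_surjective R⟩, fun g => ?_,
    fun b => ?_⟩
  · exact congrArg Subtype.val (amalgamToElementaryGroup_of R false g)
  · exact congrArg Subtype.val (amalgamToElementaryGroup_of R true b)
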